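/- Words are finite sequences over the fixed two-letter alphabet $\Sigma=\{a,b\}$. A word $z$ is a factor of $w$ if $w=pzq$ for some words $p,q$; let $f_w(i)$ be the number of distinct factors of $w$ of length $i$. A word $u$ is right (resp. left) special in $w$ if $ux$ and $uy$ (resp. $xu$ and $yu$) are factors of $w$ for two different letters $x,y$. Let $R_w$ be the least length for which $w$ has no right special factor of that length, and $K_w$ the least length of a suffix of $w$ that occurs only once in $w$; put $m_w=\min\{R_w,K_w\}$ and $M_w=\max\{R_w,K_w\}$. A non-empty word $w$ is trapezoidal if $f_w(i)=i+1$ for $0\le i\le m_w$, $f_w(i+1)=f_w(i)$ for $m_w\le i\le M_w-1$, and $f_w(i+1)=f_w(i)-1$ for $M_w\le i\le |w|$. A trapezoidal word $w$ is semicentral if its longest repeated prefix, its longest repeated suffix, its longest right special factor and its longest left special factor all exist and coincide (a prefix or suffix is repeated if it occurs at least twice in $w$; the empty word occurs $|w|+1$ times in $w$). For every integer $n\ge 1$, the number $SC(n)$ of semicentral words of length $n$ is $$SC(n)=\begin{cases}0, & \text{if } n \text{ is odd},\\ 2\,\phi\!\left(\frac n2+1\right), & \text{if } n \text{ is even},\end{cases}$$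 where $\phi$ is Euler's totient function. -/

import Mathlib

/-- Words over the fixed two-letter alphabet; the two letters are the elements of `Bool`. -/
abbrev Word : Type := List Bool

namespace Word

/-- The number of occurrences of `z` in `w`: the number of positions `i`, `0 ≤ i ≤ |w|`,
at which `z` can be read in `w`. (The empty word occurs `|w| + 1` times.) -/
def occ (z w : Word) : ℕ :=
  ((Finset.range (w.length + 1)).filter (fun i => z <+: w.drop i)).card

/-- The set of factors of `w` of length `n`. -/
def factors (w : Word) (n : ℕ) : Set Word := {z | z <:+: w ∧ z.length = n}

/-- The factor complexity `f_w(n)`. -/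
noncomputable def complexity (w : Word) (n : ℕ) : ℕ := (factors w n).ncard

/-- `u` is a left special factor of `w`. -/
def IsLeftSpecial (w u : Word) : Prop :=
  ∃ x y : Bool, x ≠ y ∧ (x :: u) <:+: w ∧ (y :: u) <:+: w

/-- `u` is a right special factor of `w`. -/
def IsRightSpecial (w u : Word) : Prop :=
  ∃ x y : Bool, x ≠ y ∧ (u ++ [x]) <:+: w ∧ (u ++ [y]) <:+: w

/-- `u` is a repeated prefix of `w`. -/
def IsRepeatedPrefix (w u : Word) : Prop := u <+: w ∧ 2 ≤ occ u w

/-- `u` is a repeated suffix of `w`. -/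
def IsRepeatedSuffix (w u : Word) : Prop := u <:+ w ∧ 2 ≤ occ u w

/-- `K_w`: the minimal length of a suffix of `w` which occurs only once in `w`. -/
noncomputable def K (w : Word) : ℕ :=
  sInf {n | ∃ z : Word, z <:+ w ∧ z.length = n ∧ occ z w = 1}

/-- `R_w`: the minimal length for which there is no right special factor of `w`. -/
noncomputable def R (w : Word) : ℕ :=
  sInf {n | ∀ z : Word, z.length = n → ¬ IsRightSpecial w z}

/-- The infimum defining `K_w` is a minimum: `w` itself is a suffix that occurs once. -/
theorem K_set_nonempty (w : Word) :
    {n | ∃ z : Word, z <:+ w ∧ z.length = n ∧ occ z w = 1}.Nonempty := by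
  refine ⟨w.length, w, List.suffix_rfl, rfl, ?_⟩
  unfold occ
  rw [Finset.card_eq_one]
  refine ⟨0, ?_⟩
  ext i
  simp only [Finset.mem_filter, Finset.mem_range, Finset.mem_singleton]
  constructor
  · rintro ⟨h1, h2⟩
    have := h2.length_le
    rw [List.length_drop] at this
    omega
  · rintro rfl
    simp

/-- The infimum defining `R_w` is a minimum: no factor has length greater than `|w|`. -/
theorem R_set_nonempty (w : Word) :
    {n | ∀ z : Word, z.length = n → ¬ IsRightSpecial w z}.Nonempty := by
  refine ⟨w.length, ?_⟩
  rintro z hz ⟨x, y, -, h, -⟩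
  have := h.length_le
  simp at this
  omega

/-- A non-empty word `w` is trapezoidal if, with `m = min R_w K_w` and `M = max R_w K_w`, its
factor complexity is `i + 1` on `[0, m]`, constant on `[m, M]`, and decreases by exactly one at
each step of `[M, |w|]`. -/
def IsTrapezoidal (w : Word) : Prop :=
  w ≠ [] ∧
  (∀ i, i ≤ min (R w) (K w) → complexity w i = i + 1) ∧
  (∀ i, min (R w) (K w) ≤ i → i < max (R w) (K w) → complexity w (i + 1) = complexity w i) ∧
  (∀ i, max (R w) (K w) ≤ i → i ≤ w.length → complexity w (i + 1) + 1 = complexity w i)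

/-- `u` is the longest word with property `P`. -/
def IsTheLongest (P : Word → Prop) (u : Word) : Prop :=
  P u ∧ ∀ v, P v → v ≠ u → v.length < u.length

/-- A trapezoidal word is semicentral if its longest repeated prefix, longest repeated suffix,
longest right special factor and longest left special factor (exist and) all coincide. -/
def IsSemicentral (w : Word) : Prop :=
  IsTrapezoidal w ∧ ∃ u : Word,
    IsTheLongest (IsRepeatedPrefix w) u ∧ IsTheLongest (IsRepeatedSuffix w) u ∧
    IsTheLongest (IsRightSpecial w) u ∧ IsTheLongest (IsLeftSpecial w) u

/-- The set of semicentral words of length `n`. -/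
def semicentralWords (n : ℕ) : Set Word := {w | w.length = n ∧ IsSemicentral w}

theorem semicentralWords_finite (n : ℕ) : (semicentralWords n).Finite :=
  (List.finite_length_eq Bool n).subset (fun _ h => h.1)

/-- `SC(n)`, the number of semicentral words of length `n`. -/
noncomputable def SC (n : ℕ) : ℕ := (semicentralWords n).ncard

end Word

namespace Word

/-! ### Positions of factors -/

/-! Let `w` be semicentral with common longest word `u`, and put `M = |u|`. Special factors and
repeated suffixes are closed under suffixes, so `R w = K w = M + 1`. The complexity is then `M + 2`
at `M + 1` and falls by one per step to `0` at `|w| + 1`, so `|w| = 2M + 2`. As `u` is both a prefix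
and a suffix, `w` has period `M + 2`: it is a window of a cyclic word `c` on `ZMod (M + 2)`.

All cyclic windows of length `M + 1` occur in `w`, and the complexity makes them distinct.
Bispeciality of `u` then gives a second occurrence of `u` at some `k`, with different neighbours on
both sides. Hence rotation by `k` changes `c` exactly at `-2` (just after `u`) and `-1` (just before
it): this is `RotatesBy` (`rotatesBy_of_special`). Conversely, this property fixes all window counts
and makes the window of length `2M + 2` semicentral (`RotatesBy.isSemicentral`).

It remains to count such `c`. The shift `k` must be a unit, and `k` with the letter at `-1`
determines `c`. For each unit and letter, `coding` supplies a solution, and different choices give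
different words. This yields `2 * φ(M + 2)`. -/

theorem isInfix_iff_exists_take_drop {z w : Word} :
    z <:+: w ↔ ∃ i, i + z.length ≤ w.length ∧ z = (w.drop i).take z.length := by
  constructor
  · rintro ⟨p, q, rfl⟩
    exact ⟨p.length, by simp, by simp⟩
  · rintro ⟨i, -, h⟩
    rw [h]
    exact (List.take_prefix _ _).isInfix.trans (List.drop_suffix _ _).isInfix

theorem two_le_occ_iff {z w : Word} :
    2 ≤ occ z w ↔ ∃ i j, i < j ∧ j + z.length ≤ w.length ∧
      z = (w.drop i).take z.length ∧ z = (w.drop j).take z.length := by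
  unfold occ
  rw [← Nat.lt_iff_add_one_le, Finset.one_lt_card]
  constructor
  · rintro ⟨i, hi, j, hj, hij⟩
    simp only [Finset.mem_filter, Finset.mem_range] at hi hj
    have hi' := hi.2.length_le
    have hj' := hj.2.length_le
    rw [List.length_drop] at hi' hj'
    rcases lt_or_gt_of_ne hij with h | h
    · exact ⟨i, j, h, by omega, List.prefix_iff_eq_take.1 hi.2, List.prefix_iff_eq_take.1 hj.2⟩
    · exact ⟨j, i, h, by omega, List.prefix_iff_eq_take.1 hj.2, List.prefix_iff_eq_take.1 hi.2⟩
  · rintro ⟨i, j, hij, hj, h1, h2⟩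
    refine ⟨i, ?_, j, ?_, hij.ne⟩ <;>
      simp only [Finset.mem_filter, Finset.mem_range]
    · exact ⟨by omega, List.prefix_iff_eq_take.2 h1⟩
    · exact ⟨by omega, List.prefix_iff_eq_take.2 h2⟩

theorem occ_pos_of_suffix {z w : Word} (h : z <:+ w) : 1 ≤ occ z w := by
  unfold occ
  rw [Nat.one_le_iff_ne_zero, ← Nat.pos_iff_ne_zero, Finset.card_pos]
  refine ⟨w.length - z.length, ?_⟩
  simp only [Finset.mem_filter, Finset.mem_range]
  refine ⟨by omega, ?_⟩
  rw [← List.suffix_iff_eq_drop.1 h]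

theorem length_lt_of_two_le_occ {z w : Word} (h : 2 ≤ occ z w) : z.length < w.length := by
  obtain ⟨i, j, hij, hj, -⟩ := two_le_occ_iff.1 h
  omega

theorem two_le_occ_of_suffix {s z w : Word} (hs : s <:+ z) (h : 2 ≤ occ z w) : 2 ≤ occ s w := by
  obtain ⟨i, j, hij, hj, h1, h2⟩ := two_le_occ_iff.1 h
  obtain ⟨p, rfl⟩ := hs
  have key : ∀ m, p ++ s = (w.drop m).take (p ++ s).length →
      s = (w.drop (m + p.length)).take s.length := by
    intro m hm
    have := congrArg (List.drop p.length) hm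
    rw [List.drop_left, List.drop_take, List.drop_drop] at this
    simpa using this
  rw [List.length_append] at hj
  exact two_le_occ_iff.2 ⟨i + p.length, j + p.length, by omega, by omega, key i h1, key j h2⟩

theorem IsRightSpecial.of_suffix {w z s : Word} (h : IsRightSpecial w z) (hs : s <:+ z) :
    IsRightSpecial w s := by
  obtain ⟨x, y, hxy, hx, hy⟩ := h
  obtain ⟨p, rfl⟩ := hs
  refine ⟨x, y, hxy, List.IsInfix.trans ?_ hx, List.IsInfix.trans ?_ hy⟩ <;>
  · rw [List.append_assoc]
    exact (List.suffix_append _ _).isInfix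

/-! ### The parameters `R` and `K` -/

/-- Suffixes of a right special factor are right special, so every length up to `u.length` is
attained. -/
theorem R_eq_length_add_one {w u : Word} (hu : IsRightSpecial w u)
    (hmax : ∀ v, IsRightSpecial w v → v.length ≤ u.length) : R w = u.length + 1 := by
  apply le_antisymm
  · apply Nat.sInf_le
    intro z hz hr
    have := hmax z hr
    omega
  · apply le_csInf (R_set_nonempty w)
    intro n hn
    by_contra hlt
    refine hn (u.drop (u.length - n)) ?_ (hu.of_suffix (List.drop_suffix _ _))
    rw [List.length_drop]
    omega

theorem K_eq_length_add_one {w u : Word} (hu : IsRepeatedSuffix w u)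
    (hmax : ∀ v, IsRepeatedSuffix w v → v.length ≤ u.length) : K w = u.length + 1 := by
  apply le_antisymm
  · apply Nat.sInf_le
    have hlt := length_lt_of_two_le_occ hu.2
    have hl : (w.drop (w.length - (u.length + 1))).length = u.length + 1 := by
      rw [List.length_drop]
      omega
    have hs : w.drop (w.length - (u.length + 1)) <:+ w := List.drop_suffix _ _
    refine ⟨_, hs, hl, le_antisymm ?_ (occ_pos_of_suffix hs)⟩
    by_contra hocc
    have := hmax _ ⟨hs, by omega⟩
    omega
  · apply le_csInf (K_set_nonempty w)
    rintro n ⟨z, hz, rfl, hocc⟩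
    by_contra hlt
    have := two_le_occ_of_suffix (List.suffix_of_suffix_length_le hz hu.1 (by omega)) hu.2
    omega

theorem IsTheLongest.length_le {P : Word → Prop} {u v : Word} (h : IsTheLongest P u) (hv : P v) :
    v.length ≤ u.length := by
  by_cases e : v = u
  · rw [e]
  · exact (h.2 v hv e).le

/-! ### Cyclic windows -/

/-- The word of length `n` read from position `a` on in the cyclic word `c`. -/
def window {N : ℕ} (c : ZMod N → Bool) (a : ZMod N) (n : ℕ) : Word :=
  (List.range n).map fun t : ℕ => c (a + t)

section window

variable {N : ℕ} (c : ZMod N → Bool)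

@[simp]
theorem length_window (a : ZMod N) (n : ℕ) : (window c a n).length = n := by
  simp [window]

@[simp]
theorem getElem_window (a : ZMod N) (n i : ℕ) (h : i < (window c a n).length) :
    (window c a n)[i] = c (a + i) := by
  simp [window]

theorem window_eq_window_iff {c d : ZMod N → Bool} {a b : ZMod N} {n : ℕ} :
    window c a n = window d b n ↔ ∀ t < n, c (a + t) = d (b + t) := by
  simp [window]

theorem take_drop_window (a : ZMod N) {n i l : ℕ} (h : i + l ≤ n) :
    ((window c a n).drop i).take l = window c (a + i) l := by
  apply List.ext_getElem
  · simp
    omega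
  · intro t h1 h2
    simp [add_assoc]

theorem window_succ (a : ZMod N) (n : ℕ) : window c a (n + 1) = window c a n ++ [c (a + n)] := by
  simp [window, List.range_succ]

theorem window_succ_cons (a : ZMod N) (n : ℕ) :
    window c a (n + 1) = c a :: window c (a + 1) n := by
  simp [window, List.range_succ_eq_map, Function.comp_def, add_assoc, add_comm (1 : ZMod N)]

theorem isInfix_window_iff {z : Word} {a : ZMod N} {n : ℕ} :
    z <:+: window c a n ↔ ∃ i : ℕ, i + z.length ≤ n ∧ z = window c (a + i) z.length := by
  rw [isInfix_iff_exists_take_drop, length_window]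
  refine exists_congr fun i => and_congr_right fun h => ?_
  rw [take_drop_window c a h]

theorem two_le_occ_window_iff {z : Word} {a : ZMod N} {n : ℕ} :
    2 ≤ occ z (window c a n) ↔ ∃ i j : ℕ, i < j ∧ j + z.length ≤ n ∧
      z = window c (a + i) z.length ∧ z = window c (a + j) z.length := by
  rw [two_le_occ_iff, length_window]
  refine exists_congr fun i => exists_congr fun j => and_congr_right fun hij =>
    and_congr_right fun h => ?_
  rw [take_drop_window c a h, take_drop_window c a (by omega)]

theorem factors_window (a : ZMod N) (n l : ℕ) :
    factors (window c a n) l = (fun i : ℕ => window c (a + i) l) '' {i | i + l ≤ n} := by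
  ext z
  simp only [factors, Set.mem_ofPred_eq, isInfix_window_iff, Set.mem_image]
  constructor
  · rintro ⟨⟨i, hi, hz⟩, rfl⟩
    exact ⟨i, hi, hz.symm⟩
  · rintro ⟨i, hi, rfl⟩
    exact ⟨⟨i, by simpa using hi, by simp⟩, by simp⟩

end window

/-! ### Windows of length `2 * M + 2` in cyclic words of length `M + 2` -/

/-- Makes `ZMod (M + 2)` nontrivial. -/
instance fact_one_lt_add_two (M : ℕ) : Fact (1 < M + 2) := ⟨by omega⟩

theorem zmod_exists_natCast {M : ℕ} (a : ZMod (M + 2)) :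
    ∃ i : ℕ, i < M + 2 ∧ (i : ZMod (M + 2)) = a :=
  ⟨a.val, ZMod.val_lt a, ZMod.natCast_zmod_val a⟩

theorem natCast_inj_of_lt {M i j : ℕ} (hi : i < M + 2) (hj : j < M + 2)
    (h : (i : ZMod (M + 2)) = j) : i = j := by
  rw [ZMod.natCast_eq_natCast_iff'] at h
  rwa [Nat.mod_eq_of_lt hi, Nat.mod_eq_of_lt hj] at h

theorem natCast_self_eq_neg_two (M : ℕ) : (M : ZMod (M + 2)) = -2 := by
  have := ZMod.natCast_self (M + 2)
  push_cast at this
  linear_combination this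

/-- The cyclic word `c` is almost invariant under the rotation by `k`: it changes exactly at the
last two positions. -/
def RotatesBy {M : ℕ} (c : ZMod (M + 2) → Bool) (k : ZMod (M + 2)) : Prop :=
  ∀ i, c (i + k) ≠ c i ↔ i = -2 ∨ i = -1

section cyclic

variable {M : ℕ} (c : ZMod (M + 2) → Bool)

/-- For such `l` there are at least `M + 2` consecutive starting positions, so every residue occurs.
-/
theorem factors_window_eq_range {l : ℕ} (hl : l ≤ M + 1) :
    factors (window c 0 (2 * M + 2)) l = Set.range fun a => window c a l := by
  rw [factors_window]
  ext z
  simp only [Set.mem_image, Set.mem_ofPred_eq, zero_add, Set.mem_range]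
  constructor
  · rintro ⟨i, -, rfl⟩
    exact ⟨i, rfl⟩
  · rintro ⟨a, rfl⟩
    obtain ⟨i, hi, rfl⟩ := zmod_exists_natCast a
    exact ⟨i, by omega, rfl⟩

theorem ncard_range_window_le (l : ℕ) : (Set.range fun a => window c a l).ncard ≤ M + 2 := by
  rw [← Set.image_univ]
  refine (Set.ncard_image_le Set.finite_univ).trans ?_
  rw [Set.ncard_univ, Nat.card_zmod]

variable {c} {k : ZMod (M + 2)}

theorem RotatesBy.apply_add (h : RotatesBy c k) {i : ZMod (M + 2)} (h2 : i ≠ -2) (h1 : i ≠ -1) :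
    c (i + k) = c i := by
  by_contra hne
  rcases (h i).1 hne with e | e
  · exact h2 e
  · exact h1 e

theorem RotatesBy.ne_zero (h : RotatesBy c k) : k ≠ 0 := by
  rintro rfl
  exact (h (-1)).2 (Or.inr rfl) (by rw [add_zero])

theorem RotatesBy.apply_natCast_add (h : RotatesBy c k) {t : ℕ} (ht : t < M) :
    c (t + k) = c t := by
  apply h.apply_add
  · rw [← natCast_self_eq_neg_two]
    intro e
    have := natCast_inj_of_lt (by omega) (by omega) e
    omega
  · intro e
    have e' : (t : ZMod (M + 2)) = (M + 1 : ℕ) := by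
      rw [e]
      push_cast
      rw [natCast_self_eq_neg_two]
      ring
    have := natCast_inj_of_lt (by omega) (by omega) e'
    omega

/-- The window starting at `M - l` stops just before position `M = -2`, the first place where the
rotation changes a letter. -/
theorem RotatesBy.window_eq (h : RotatesBy c k) {l : ℕ} (hl : l ≤ M) :
    window c ((M - l : ℕ) + k) l = window c (M - l : ℕ) l := by
  rw [window_eq_window_iff]
  intro t ht
  have := h.apply_natCast_add (t := M - l + t) (by omega)
  rw [← Nat.cast_add, ← this]
  push_cast
  ring_nf

theorem RotatesBy.apply_last_ne (h : RotatesBy c k) {l : ℕ} (hl : l ≤ M) :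
    c ((M - l : ℕ) + k + l) ≠ c ((M - l : ℕ) + l) := by
  have e : ((M - l : ℕ) : ZMod (M + 2)) + l = -2 := by
    rw [← Nat.cast_add, Nat.sub_add_cancel hl, natCast_self_eq_neg_two]
  rw [add_right_comm, e]
  exact (h (-2)).2 (Or.inl rfl)

/-- Deleting the last letter maps windows of length `l + 1` onto those of length `l`. It is not
injective: the windows at `M - l` and `M - l + k` differ only in their last letter. -/
theorem RotatesBy.ncard_lt (h : RotatesBy c k) {l : ℕ} (hl : l ≤ M) :
    (Set.range fun a => window c a l).ncard < (Set.range fun a => window c a (l + 1)).ncard := by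
  have himg : (Set.range fun a => window c a l) =
      List.dropLast '' Set.range fun a => window c a (l + 1) := by
    rw [← Set.range_comp]
    congr 1
    funext a
    simp [window_succ]
  rw [himg]
  refine lt_of_le_of_ne (Set.ncard_image_le (Set.finite_range _)) fun he => ?_
  have hinj := (Set.ncard_image_iff (Set.finite_range _)).1 he
  have := hinj ⟨(M - l : ℕ) + k, rfl⟩ ⟨(M - l : ℕ), rfl⟩ (by simp [window_succ, h.window_eq hl])
  simp only [window_succ, h.window_eq hl] at this
  exact h.apply_last_ne hl (by simpa using this)

/-- The counts increase strictly from at least `1` at length `0` to at most `M + 2` at length `M +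
1`, which leaves no slack. -/
theorem RotatesBy.ncard_range_window (h : RotatesBy c k) {l : ℕ} (hl : l ≤ M + 1) :
    (Set.range fun a => window c a l).ncard = l + 1 := by
  have lower : ∀ m ≤ M + 1, m + 1 ≤ (Set.range fun a => window c a m).ncard := by
    intro m
    induction m with
    | zero =>
      intro _
      rw [Nat.zero_add, Nat.one_le_iff_ne_zero, ← Nat.pos_iff_ne_zero,
        Set.ncard_pos (Set.finite_range _)]
      exact Set.range_nonempty _
    | succ m ih =>
      intro hm
      have := ih (by omega)
      have := h.ncard_lt (l := m) (by omega)
      omega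
  have upper : ∀ j ≤ M + 1, (Set.range fun a => window c a (M + 1 - j)).ncard ≤ M + 2 - j := by
    intro j
    induction j with
    | zero => exact fun _ => ncard_range_window_le c _
    | succ j ih =>
      intro hj
      have h1 := ih (by omega)
      have h2 := h.ncard_lt (l := M + 1 - (j + 1)) (by omega)
      rw [show M + 1 - (j + 1) + 1 = M + 1 - j by omega] at h2
      omega
  have h1 := lower l hl
  have h2 := upper (M + 1 - l) (by omega)
  rw [show M + 1 - (M + 1 - l) = l by omega] at h2
  omega

theorem injective_window_of_ncard
    (h : (Set.range fun a => window c a (M + 1)).ncard = M + 2) :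
    Function.Injective fun a => window c a (M + 1) := by
  rw [← Set.injOn_univ, ← Set.ncard_image_iff Set.finite_univ, Set.image_univ, h, Set.ncard_univ,
    Nat.card_zmod]

theorem RotatesBy.injective_window (h : RotatesBy c k) {l : ℕ} (hl : M + 1 ≤ l) :
    Function.Injective fun a => window c a l := by
  intro a b hab
  refine injective_window_of_ncard (h.ncard_range_window le_rfl) ?_
  simp only [window_eq_window_iff] at hab ⊢
  exact fun t ht => hab t (by omega)

theorem RotatesBy.length_le_of_window_eq (h : RotatesBy c k) {l : ℕ} {a b : ZMod (M + 2)}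
    (hab : a ≠ b) (hw : window c a l = window c b l) : l ≤ M := by
  by_contra hl
  exact hab (h.injective_window (l := l) (by omega) hw)

theorem RotatesBy.window_eq_zero (h : RotatesBy c k) :
    window c k M = window c 0 M := by
  simpa using h.window_eq (le_refl M)

/-- There are `M + 2` positions but `M + 1` windows of length `M`, so the collision between `0` and
`k` is the only one. -/
theorem RotatesBy.eq_window_of_window_eq (h : RotatesBy c k) {a b : ZMod (M + 2)}
    (hab : a ≠ b) (hw : window c a M = window c b M) : window c a M = window c 0 M := by
  have himg : (fun a => window c a M) '' {k}ᶜ = Set.range fun a => window c a M := by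
    ext z
    constructor
    · rintro ⟨a, -, rfl⟩
      exact ⟨a, rfl⟩
    · rintro ⟨a, rfl⟩
      by_cases ha : a = k
      · exact ⟨0, h.ne_zero.symm, by rw [ha]; exact h.window_eq_zero.symm⟩
      · exact ⟨a, ha, rfl⟩
  have hcard : ((fun a => window c a M) '' {k}ᶜ).ncard = ({k}ᶜ : Set (ZMod (M + 2))).ncard := by
    rw [himg, h.ncard_range_window (by omega), Set.ncard_compl, Nat.card_zmod,
      Set.ncard_singleton]
    omega
  have hinj := (Set.ncard_image_iff (Set.toFinite _)).1 hcard
  by_cases ha : a = k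
  · rw [ha, h.window_eq_zero]
  by_cases hb : b = k
  · rw [hw, hb, h.window_eq_zero]
  exact absurd (hinj ha hb hw) hab

theorem IsRightSpecial.exists_window_eq {n : ℕ} {v : Word}
    (hv : IsRightSpecial (window c 0 n) v) :
    ∃ a b : ZMod (M + 2), a ≠ b ∧ c (a + v.length) ≠ c (b + v.length) ∧
      v = window c a v.length ∧ v = window c b v.length := by
  obtain ⟨x, y, hxy, hx, hy⟩ := hv
  obtain ⟨i, -, hi⟩ := (isInfix_window_iff c).1 hx
  obtain ⟨j, -, hj⟩ := (isInfix_window_iff c).1 hy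
  simp only [List.length_append, List.length_singleton, window_succ] at hi hj
  obtain ⟨hi1, hi2⟩ := List.append_inj' hi rfl
  obtain ⟨hj1, hj2⟩ := List.append_inj' hj rfl
  have hne : c (0 + (i : ZMod (M + 2)) + v.length) ≠ c (0 + (j : ZMod (M + 2)) + v.length) := by
    rw [← List.singleton_inj.1 hi2, ← List.singleton_inj.1 hj2]
    exact hxy
  exact ⟨_, _, fun e => hne (by rw [e]), hne, hi1, hj1⟩

theorem IsLeftSpecial.exists_window_eq {n : ℕ} {v : Word}
    (hv : IsLeftSpecial (window c 0 n) v) :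
    ∃ a b : ZMod (M + 2), a ≠ b ∧ c (a - 1) ≠ c (b - 1) ∧
      v = window c a v.length ∧ v = window c b v.length := by
  obtain ⟨x, y, hxy, hx, hy⟩ := hv
  obtain ⟨i, -, hi⟩ := (isInfix_window_iff c).1 hx
  obtain ⟨j, -, hj⟩ := (isInfix_window_iff c).1 hy
  simp only [List.length_cons, window_succ_cons, List.cons.injEq] at hi hj
  have hne : c (0 + (i : ZMod (M + 2)) + 1 - 1) ≠ c (0 + (j : ZMod (M + 2)) + 1 - 1) := by
    rw [add_sub_cancel_right, add_sub_cancel_right, ← hi.1, ← hj.1]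
    exact hxy
  exact ⟨_, _, fun e => hne (by rw [e]), hne, hi.2, hj.2⟩

theorem exists_window_eq_of_two_le_occ {v : Word} (hl : M + 1 ≤ v.length)
    (hv : 2 ≤ occ v (window c 0 (2 * M + 2))) :
    ∃ a b : ZMod (M + 2), a ≠ b ∧ v = window c a v.length ∧ v = window c b v.length := by
  obtain ⟨i, j, hij, hj, h1, h2⟩ := (two_le_occ_window_iff c).1 hv
  refine ⟨_, _, fun e => ?_, h1, h2⟩
  rw [zero_add, zero_add] at e
  have := natCast_inj_of_lt (by omega) (by omega) e
  omega

theorem RotatesBy.length_le_of_two_le_occ (h : RotatesBy c k) {v : Word}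
    (hv : 2 ≤ occ v (window c 0 (2 * M + 2))) : v.length ≤ M := by
  by_contra hl
  obtain ⟨a, b, hab, h1, h2⟩ := exists_window_eq_of_two_le_occ (by omega) hv
  exact hl (h.length_le_of_window_eq hab (h1.symm.trans h2))

theorem window_prefix : window c 0 M <+: window c 0 (2 * M + 2) := by
  rw [List.prefix_iff_eq_take, length_window]
  simpa using (take_drop_window c 0 (n := 2 * M + 2) (i := 0) (l := M) (by omega)).symm

theorem natCast_add_two_eq_zero (M : ℕ) : ((M + 2 : ℕ) : ZMod (M + 2)) = 0 :=
  ZMod.natCast_self _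

theorem window_suffix : window c 0 M <:+ window c 0 (2 * M + 2) := by
  rw [List.suffix_iff_eq_drop, length_window, length_window]
  have := take_drop_window c 0 (n := 2 * M + 2) (i := M + 2) (l := M) (by omega)
  rw [natCast_add_two_eq_zero, add_zero] at this
  rw [← this, show 2 * M + 2 - M = M + 2 by omega, List.take_of_length_le]
  simp
  omega

theorem two_le_occ_window : 2 ≤ occ (window c 0 M) (window c 0 (2 * M + 2)) := by
  rw [two_le_occ_window_iff]
  refine ⟨0, M + 2, by omega, by simp; omega, by simp, ?_⟩
  rw [natCast_add_two_eq_zero]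
  simp

theorem window_isInfix {l : ℕ} (hl : l ≤ M + 1) (a : ZMod (M + 2)) :
    window c a l <:+: window c 0 (2 * M + 2) := by
  have : window c a l ∈ factors (window c 0 (2 * M + 2)) l := by
    rw [factors_window_eq_range c hl]
    exact ⟨a, rfl⟩
  exact this.1

theorem RotatesBy.isRightSpecial (h : RotatesBy c k) :
    IsRightSpecial (window c 0 (2 * M + 2)) (window c 0 M) := by
  refine ⟨c (k + M), c (0 + M), by simpa using h.apply_last_ne (le_refl M), ?_, ?_⟩
  · rw [← h.window_eq_zero, ← window_succ]
    exact window_isInfix le_rfl _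
  · rw [← window_succ]
    exact window_isInfix le_rfl _

theorem RotatesBy.isLeftSpecial (h : RotatesBy c k) :
    IsLeftSpecial (window c 0 (2 * M + 2)) (window c 0 M) := by
  refine ⟨c (-1 + k), c (-1), (h (-1)).2 (Or.inr rfl), ?_, ?_⟩
  · rw [← h.window_eq_zero]
    have := window_isInfix (c := c) (le_refl (M + 1)) (-1 + k)
    rwa [window_succ_cons, add_right_comm, neg_add_cancel, zero_add] at this
  · have := window_isInfix (c := c) (le_refl (M + 1)) (-1)
    rwa [window_succ_cons, neg_add_cancel] at this

theorem isTheLongest_window {P : Word → Prop} (hu : P (window c 0 M))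
    (hle : ∀ v, P v → v.length ≤ M) (heq : ∀ v, P v → v.length = M → v = window c 0 M) :
    IsTheLongest P (window c 0 M) := by
  refine ⟨hu, fun v hv hne => ?_⟩
  rw [length_window]
  exact lt_of_le_of_ne (hle v hv) fun e => hne (heq v hv e)

theorem RotatesBy.complexity_of_le (h : RotatesBy c k) {l : ℕ} (hl : l ≤ M + 1) :
    complexity (window c 0 (2 * M + 2)) l = l + 1 := by
  rw [complexity, factors_window_eq_range c hl, h.ncard_range_window hl]

theorem RotatesBy.complexity_of_ge (h : RotatesBy c k) {l : ℕ} (hl : M + 1 ≤ l) :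
    complexity (window c 0 (2 * M + 2)) l = 2 * M + 3 - l := by
  rw [complexity, factors_window, Set.InjOn.ncard_image]
  · have : {i : ℕ | i + l ≤ 2 * M + 2} = (Finset.range (2 * M + 3 - l) : Set ℕ) := by
      ext i
      simp
      omega
    rw [this, Set.ncard_coe_finset, Finset.card_range]
  · intro i hi j hj e
    simp only [zero_add, Set.mem_ofPred_eq] at hi hj e
    exact natCast_inj_of_lt (by omega) (by omega) (h.injective_window hl e)

theorem RotatesBy.isSemicentral (h : RotatesBy c k) :
    IsSemicentral (window c 0 (2 * M + 2)) := by
  have hpre : IsTheLongest (IsRepeatedPrefix (window c 0 (2 * M + 2))) (window c 0 M) := by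
    refine isTheLongest_window ⟨window_prefix, two_le_occ_window⟩
      (fun v hv => h.length_le_of_two_le_occ hv.2) fun v hv e => ?_
    exact (List.prefix_of_prefix_length_le hv.1 window_prefix (by simp [e])).eq_of_length
      (by simp [e])
  have hsuf : IsTheLongest (IsRepeatedSuffix (window c 0 (2 * M + 2))) (window c 0 M) := by
    refine isTheLongest_window ⟨window_suffix, two_le_occ_window⟩
      (fun v hv => h.length_le_of_two_le_occ hv.2) fun v hv e => ?_
    exact (List.suffix_of_suffix_length_le hv.1 window_suffix (by simp [e])).eq_of_length
      (by simp [e])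
  have hR : IsTheLongest (IsRightSpecial (window c 0 (2 * M + 2))) (window c 0 M) := by
    refine isTheLongest_window h.isRightSpecial (fun v hv => ?_) fun v hv e => ?_
    · obtain ⟨a, b, hab, -, h1, h2⟩ := hv.exists_window_eq
      exact h.length_le_of_window_eq hab (h1.symm.trans h2)
    · obtain ⟨a, b, hab, -, h1, h2⟩ := hv.exists_window_eq
      rw [e] at h1 h2
      exact h1.trans (h.eq_window_of_window_eq hab (h1.symm.trans h2))
  have hL : IsTheLongest (IsLeftSpecial (window c 0 (2 * M + 2))) (window c 0 M) := by
    refine isTheLongest_window h.isLeftSpecial (fun v hv => ?_) fun v hv e => ?_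
    · obtain ⟨a, b, hab, -, h1, h2⟩ := hv.exists_window_eq
      exact h.length_le_of_window_eq hab (h1.symm.trans h2)
    · obtain ⟨a, b, hab, -, h1, h2⟩ := hv.exists_window_eq
      rw [e] at h1 h2
      exact h1.trans (h.eq_window_of_window_eq hab (h1.symm.trans h2))
  refine ⟨⟨?_, ?_⟩, window c 0 M, hpre, hsuf, hR, hL⟩
  · intro e
    simpa using congrArg List.length e
  · rw [R_eq_length_add_one hR.1 fun v => hR.length_le,
      K_eq_length_add_one hsuf.1 fun v => hsuf.length_le]
    simp only [length_window, min_self, max_self]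
    refine ⟨fun i hi => h.complexity_of_le hi, fun i h1 h2 => by omega, fun i h1 h2 => ?_⟩
    rw [h.complexity_of_ge h1, h.complexity_of_ge (by omega)]
    omega

end cyclic

/-! ### Semicentral words are windows of cyclic words -/

theorem complexity_eq_zero_of_length_lt {w : Word} {l : ℕ} (h : w.length < l) :
    complexity w l = 0 := by
  have : factors w l = ∅ := by
    ext z
    simp only [factors, Set.mem_ofPred_eq, Set.mem_empty_iff_false, iff_false]
    rintro ⟨h1, h2⟩
    have := h1.length_le
    omega
  rw [complexity, this, Set.ncard_empty]

theorem IsTrapezoidal.length_eq {w : Word} {m : ℕ} (h : IsTrapezoidal w) (hR : R w = m + 1)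
    (hK : K w = m + 1) (hm : m < w.length) :
    complexity w (m + 1) = m + 2 ∧ w.length = 2 * m + 2 := by
  obtain ⟨-, h1, -, h3⟩ := h
  rw [hR, hK, min_self] at h1
  rw [hR, hK, max_self] at h3
  have h0 := h1 (m + 1) le_rfl
  have key : ∀ j, m + 1 + j ≤ w.length + 1 → complexity w (m + 1 + j) + j = m + 2 := by
    intro j
    induction j with
    | zero => intro _; simpa using h0
    | succ j ih =>
      intro hj
      have e1 := ih (by omega)
      have e2 := h3 (m + 1 + j) (by omega) (by omega)
      rw [← add_assoc (m + 1) j 1]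
      omega
  refine ⟨h0, ?_⟩
  have := key (w.length - m) (by omega)
  rw [complexity_eq_zero_of_length_lt (by omega)] at this
  omega

theorem eq_window_of_prefix_of_suffix {w u : Word} (hp : u <+: w) (hs : u <:+ w)
    (hl : w.length = 2 * u.length + 2) :
    ∃ c : ZMod (u.length + 2) → Bool,
      w = window c 0 (2 * u.length + 2) ∧ u = window c 0 u.length := by
  -- The default is never reached, since `a.val < u.length + 2 ≤ w.length`.
  refine ⟨fun a => w.getD a.val false, ?_, ?_⟩
  · apply List.ext_getElem
    · simpa using hl
    · intro i h1 h2
      rw [getElem_window, zero_add, ZMod.val_natCast]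
      by_cases hi : i < u.length + 2
      · rw [Nat.mod_eq_of_lt hi, List.getD_eq_getElem _ _ h1]
      · obtain ⟨t, rfl⟩ : ∃ t, i = u.length + 2 + t := ⟨i - (u.length + 2), by omega⟩
        have ht : t < u.length := by omega
        rw [Nat.add_mod_left, Nat.mod_eq_of_lt (by omega),
          List.getD_eq_getElem _ _ (by omega), ← hp.getElem ht]
        have := List.suffix_iff_eq_drop.1 hs
        rw [hl, show 2 * u.length + 2 - u.length = u.length + 2 by omega] at this
        conv_rhs => rw [List.getElem_of_eq this ht]
        simp
  · apply List.ext_getElem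
    · simp
    · intro i h1 h2
      rw [getElem_window, zero_add, ZMod.val_natCast, Nat.mod_eq_of_lt (by omega),
        List.getD_eq_getElem _ _ (by omega), ← hp.getElem h1]

theorem rotatesBy_of_special {M : ℕ} {c : ZMod (M + 2) → Bool}
    (hinj : Function.Injective fun a => window c a (M + 1))
    (hR : IsRightSpecial (window c 0 (2 * M + 2)) (window c 0 M))
    (hL : IsLeftSpecial (window c 0 (2 * M + 2)) (window c 0 M)) :
    ∃ k, RotatesBy c k := by
  have injR : ∀ a b, window c a M = window c b M → c (a + M) = c (b + M) → a = b := by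
    intro a b h1 h2
    apply hinj
    simp only [window_succ, h1, h2]
  have injL : ∀ a b, window c a M = window c b M → c (a - 1) = c (b - 1) → a = b := by
    intro a b h1 h2
    have : a - 1 = b - 1 := by
      apply hinj
      simp only [window_succ_cons, h2, sub_add_cancel, h1]
    simpa using this
  have hk : ∃ k, window c k M = window c 0 M ∧ c (k + M) ≠ c (0 + M) := by
    obtain ⟨a, b, -, hne, h1, h2⟩ := hR.exists_window_eq
    rw [length_window] at hne h1 h2
    by_cases ha : c (a + M) = c (0 + M)
    · exact ⟨b, h2.symm, fun hb => hne (ha.trans hb.symm)⟩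
    · exact ⟨a, h1.symm, ha⟩
  have hk' : ∃ k, window c k M = window c 0 M ∧ c (k - 1) ≠ c (0 - 1) := by
    obtain ⟨a, b, -, hne, h1, h2⟩ := hL.exists_window_eq
    rw [length_window] at h1 h2
    by_cases ha : c (a - 1) = c (0 - 1)
    · exact ⟨b, h2.symm, fun hb => hne (ha.trans hb.symm)⟩
    · exact ⟨a, h1.symm, ha⟩
  obtain ⟨k, hw, hr⟩ := hk
  obtain ⟨k', hw', hl⟩ := hk'
  -- The occurrence at `k'` cannot share its next letter with the one at `0`, or they would
  -- coincide; with two letters it shares it with the one at `k`.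
  have hkk : k' = k := by
    apply injR _ _ (hw'.trans hw.symm)
    have h0 : c (k' + M) ≠ c (0 + M) := fun e => hl (by rw [injR _ _ hw' e])
    rw [Bool.eq_not_of_ne h0, Bool.eq_not_of_ne hr]
  subst hkk
  refine ⟨k', fun i => ⟨fun hne => ?_, ?_⟩⟩
  · obtain ⟨t, ht, rfl⟩ := zmod_exists_natCast i
    by_cases htM : t < M
    · refine absurd ?_ hne
      have := window_eq_window_iff.1 hw t htM
      rwa [zero_add, add_comm] at this
    · rcases (show t = M ∨ t = M + 1 by omega) with rfl | rfl
      · exact Or.inl (natCast_self_eq_neg_two _)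
      · right
        push_cast
        rw [natCast_self_eq_neg_two]
        ring
  · rintro (rfl | rfl)
    · rw [natCast_self_eq_neg_two, zero_add, add_comm] at hr
      exact hr
    · rw [zero_sub, sub_eq_add_neg, add_comm] at hl
      exact hl

theorem IsSemicentral.exists_rotatesBy {w : Word} (h : IsSemicentral w) :
    ∃ M, w.length = 2 * M + 2 ∧
      ∃ (c : ZMod (M + 2) → Bool) (k : ZMod (M + 2)),
        RotatesBy c k ∧ w = window c 0 (2 * M + 2) := by
  obtain ⟨ht, u, hp, hs, hR, hL⟩ := h
  obtain ⟨hc, hl⟩ := ht.length_eq (R_eq_length_add_one hR.1 fun v => hR.length_le)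
    (K_eq_length_add_one hs.1 fun v => hs.length_le) (length_lt_of_two_le_occ hs.1.2)
  obtain ⟨c, hw, hu⟩ := eq_window_of_prefix_of_suffix hp.1.1 hs.1.1 hl
  have hR' := hR.1
  have hL' := hL.1
  -- The type of `c` mentions `u.length`, which must become a variable before `u` is replaced by a
  -- window of `c`.
  generalize u.length = M at *
  subst hw hu
  rw [complexity, factors_window_eq_range c le_rfl] at hc
  obtain ⟨k, hk⟩ := rotatesBy_of_special (injective_window_of_ncard hc) hR' hL'
  exact ⟨M, hl, c, k, hk, rfl⟩

/-! ### Classification of the cyclic words -/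

/-- The cyclic word that is almost invariant under the rotation by the inverse of `j` and has the
letter `y` at the last position. -/
def coding {M : ℕ} (j : ZMod (M + 2)) (y : Bool) (i : ZMod (M + 2)) : Bool :=
  if ((i + 2) * j - 1).val < j.val then y else !y

theorem val_sub_one {M : ℕ} {t : ZMod (M + 2)} (ht : t ≠ 0) : (t - 1).val = t.val - 1 := by
  have h1 : 1 ≤ t.val := Nat.one_le_iff_ne_zero.2 (by simpa [ZMod.val_eq_zero] using ht)
  have e : t - 1 = ((t.val - 1 : ℕ) : ZMod (M + 2)) := by
    rw [Nat.cast_sub h1, ZMod.natCast_zmod_val, Nat.cast_one]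
  have := ZMod.val_lt t
  rw [e, ZMod.val_natCast, Nat.mod_eq_of_lt (by omega)]

theorem val_zero_sub_one (M : ℕ) : ((0 : ZMod (M + 2)) - 1).val = M + 1 := by
  rw [zero_sub, ZMod.val_neg_one]

/-- In the coordinate `s = (i + 2) * j - 1`, rotation by `k` is `s ↦ s + 1` and the letter `y` fills
`0 ≤ s < j.val`. This interval is entered from `s = -1` (`i = -2`) and left from `s = j - 1` (`i =
-1`). -/
theorem coding_rotatesBy {M : ℕ} {j k : ZMod (M + 2)} (hjk : k * j = 1) (y : Bool) :
    RotatesBy (coding j y) k := by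
  intro i
  have hj : j ≠ 0 := by
    rintro rfl
    exact zero_ne_one ((mul_zero k).symm.trans hjk)
  have hj1 : 1 ≤ j.val := Nat.one_le_iff_ne_zero.2 (by simpa [ZMod.val_eq_zero] using hj)
  have hjlt := ZMod.val_lt j
  have e1 : (i + k + 2) * j - 1 = (i + 2) * j := by linear_combination hjk
  have h2 : i = -2 ↔ (i + 2) * j = 0 := by
    constructor
    · rintro rfl
      ring
    · intro h
      linear_combination k * h - (i + 2) * hjk
  have h1 : i = -1 ↔ (i + 2) * j = j := by
    constructor
    · rintro rfl
      ring
    · intro h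
      linear_combination k * h - (i + 1) * hjk
  unfold coding
  rw [e1, h1, h2]
  generalize (i + 2) * j = t
  by_cases ht : t = 0
  · subst ht
    rw [val_zero_sub_one, ZMod.val_zero, if_pos (by omega), if_neg (by omega)]
    simp
  · have h1t : 1 ≤ t.val := Nat.one_le_iff_ne_zero.2 (by simpa [ZMod.val_eq_zero] using ht)
    rw [val_sub_one ht, ← (ZMod.val_injective (M + 2)).eq_iff (a := t) (b := j)]
    simp only [ht, false_or]
    rcases lt_trichotomy t.val j.val with h | h | h
    · rw [if_pos h, if_pos (by omega)]
      simp [h.ne]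
    · rw [if_neg (by omega), if_pos (by omega)]
      simp [h]
    · rw [if_neg (by omega), if_neg (by omega)]
      simp [h.ne']

theorem coding_neg_one {M : ℕ} {j : ZMod (M + 2)} (hj : j ≠ 0) (y : Bool) :
    coding j y (-1) = y := by
  have hj1 : 1 ≤ j.val := Nat.one_le_iff_ne_zero.2 (by simpa [ZMod.val_eq_zero] using hj)
  have e : ((-1 : ZMod (M + 2)) + 2) * j - 1 = j - 1 := by ring
  rw [coding, e, val_sub_one hj, if_pos (by omega)]

theorem card_filter_val_lt {M : ℕ} (m : ℕ) (hm : m ≤ M + 2) :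
    (Finset.univ.filter fun t : ZMod (M + 2) => t.val < m).card = m := by
  have : (Finset.univ.filter fun t : ZMod (M + 2) => t.val < m) =
      (Finset.range m).image fun i : ℕ => (i : ZMod (M + 2)) := by
    ext t
    simp only [Finset.mem_filter, Finset.mem_univ, true_and, Finset.mem_image, Finset.mem_range]
    constructor
    · exact fun h => ⟨t.val, h, ZMod.natCast_zmod_val t⟩
    · rintro ⟨i, hi, rfl⟩
      rwa [ZMod.val_natCast, Nat.mod_eq_of_lt (by omega)]
  rw [this, Finset.card_image_of_injOn, Finset.card_range]
  intro i hi i' hi' e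
  simp only [Finset.coe_range, Set.mem_Iio] at hi hi'
  exact natCast_inj_of_lt (by omega) (by omega) e

theorem card_coding_eq {M : ℕ} {j k : ZMod (M + 2)} (hjk : k * j = 1) (y : Bool) :
    (Finset.univ.filter fun i => coding j y i = y).card = j.val := by
  rw [← card_filter_val_lt j.val (ZMod.val_lt j).le]
  apply Finset.card_bij' (fun i _ => (i + 2) * j - 1) (fun t _ => (t + 1) * k - 2)
  · intro i hi
    simpa [coding] using hi
  · intro t ht
    have e : ((t + 1) * k - 2 + 2) * j - 1 = t := by linear_combination (t + 1) * hjk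
    simp only [Finset.mem_filter, Finset.mem_univ, true_and] at ht ⊢
    rw [coding, e, if_pos ht]
  · intro i _
    linear_combination (i + 2) * hjk
  · intro t _
    linear_combination (t + 1) * hjk

/-- Along the orbit of `-1` under adding `k`, the letter flips on leaving `-1` and must flip back
before returning. So the orbit meets `-2`, and `-1 + m * k = -2` inverts `k`. -/
theorem RotatesBy.isUnit {M : ℕ} {c : ZMod (M + 2) → Bool} {k : ZMod (M + 2)}
    (h : RotatesBy c k) : IsUnit k := by
  by_contra hk
  have hstep : ∀ m : ℕ, m < addOrderOf k → c (-1 + (m + 1) * k) = !c (-1) := by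
    intro m
    induction m with
    | zero =>
      intro _
      have := (h (-1)).2 (Or.inr rfl)
      simpa using Bool.eq_not_of_ne this
    | succ m ih =>
      intro hm
      rw [← ih (by omega)]
      have e : (-1 : ZMod (M + 2)) + ((m + 1 : ℕ) + 1) * k = -1 + (m + 1) * k + k := by
        push_cast
        ring
      rw [e]
      apply h.apply_add
      · intro e2
        refine hk (IsUnit.of_mul_eq_one (-(m + 1 : ZMod (M + 2))) ?_)
        linear_combination -e2
      · intro e1
        have e0 : (m + 1) • k = 0 := by
          rw [nsmul_eq_mul]
          push_cast
          linear_combination e1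
        have := addOrderOf_le_of_nsmul_eq_zero (by omega) e0
        omega
  have hpos : 0 < addOrderOf k := addOrderOf_pos k
  have := hstep (addOrderOf k - 1) (by omega)
  rw [← Nat.cast_add_one, Nat.sub_add_cancel hpos, ← nsmul_eq_mul, addOrderOf_nsmul_eq_zero,
    add_zero] at this
  simp at this

theorem RotatesBy.eq_of_apply_neg_one {M : ℕ} {c d : ZMod (M + 2) → Bool} {k : ZMod (M + 2)}
    (hc : RotatesBy c k) (hd : RotatesBy d k) (h : c (-1) = d (-1)) : c = d := by
  have step : ∀ i, c i = d i → c (i + k) = d (i + k) := by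
    intro i hi
    by_cases hi' : i = -2 ∨ i = -1
    · rw [Bool.eq_not_of_ne ((hc i).2 hi'), Bool.eq_not_of_ne ((hd i).2 hi'), hi]
    · rw [not_or] at hi'
      rw [hc.apply_add hi'.1 hi'.2, hd.apply_add hi'.1 hi'.2, hi]
  have all : ∀ m : ℕ, c (-1 + m * k) = d (-1 + m * k) := by
    intro m
    induction m with
    | zero => simpa using h
    | succ m ih =>
      have := step _ ih
      rw [add_assoc] at this
      rwa [Nat.cast_add_one, add_one_mul]
  obtain ⟨j, hj⟩ := hc.isUnit.exists_left_inv
  funext i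
  obtain ⟨m, -, hm⟩ := zmod_exists_natCast ((i + 1) * j)
  have := all m
  rw [hm, mul_assoc, hj] at this
  simpa using this

/-- The letter at `-1` recovers `y`, and the number of occurrences of `y` recovers `j`. -/
theorem coding_injective {M : ℕ} {j j' : (ZMod (M + 2))ˣ} {y y' : Bool}
    (h : coding (j : ZMod (M + 2)) y = coding (j' : ZMod (M + 2)) y') : j = j' ∧ y = y' := by
  have hy : y = y' := by
    rw [← coding_neg_one j.ne_zero y, ← coding_neg_one j'.ne_zero y', h]
  subst hy
  refine ⟨Units.ext (ZMod.val_injective _ ?_), rfl⟩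
  rw [← card_coding_eq j.inv_mul y, ← card_coding_eq j'.inv_mul y, h]

theorem window_injective {M : ℕ} :
    Function.Injective fun c : ZMod (M + 2) → Bool => window c 0 (2 * M + 2) := by
  intro c d h
  funext i
  obtain ⟨t, ht, rfl⟩ := zmod_exists_natCast i
  by_cases htM : t < 2 * M + 2
  · simpa using window_eq_window_iff.1 h t htM
  · omega

/-! ### Enumeration -/

theorem semicentralWords_eq_range (M : ℕ) :
    semicentralWords (2 * M + 2) = Set.range fun p : (ZMod (M + 2))ˣ × Bool =>
      window (coding (p.1 : ZMod (M + 2)) p.2) 0 (2 * M + 2) := by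
  ext w
  constructor
  · rintro ⟨hl, hw⟩
    obtain ⟨M', hl', c, k, hc, rfl⟩ := hw.exists_rotatesBy
    obtain rfl : M' = M := by omega
    obtain ⟨v, rfl⟩ := hc.isUnit
    refine ⟨(v⁻¹, c (-1)), ?_⟩
    simp only
    congr 1
    exact (coding_rotatesBy v.mul_inv _).eq_of_apply_neg_one hc (coding_neg_one v⁻¹.ne_zero _)
  · rintro ⟨⟨j, y⟩, rfl⟩
    exact ⟨by simp, (coding_rotatesBy j.inv_mul y).isSemicentral⟩

theorem SC_two_mul_add_two (M : ℕ) : SC (2 * M + 2) = 2 * Nat.totient (M + 2) := by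
  rw [SC, semicentralWords_eq_range, ← Set.image_univ, Set.ncard_image_of_injective,
    Set.ncard_univ, Nat.card_prod, Nat.card_eq_fintype_card, ZMod.card_units_eq_totient,
    Nat.card_eq_fintype_card, Fintype.card_bool, mul_comm]
  rintro ⟨j, y⟩ ⟨j', y'⟩ h
  obtain ⟨rfl, rfl⟩ := coding_injective (window_injective h)
  rfl

theorem SC_of_odd {n : ℕ} (hn : Odd n) : SC n = 0 := by
  have : semicentralWords n = ∅ := by
    ext w
    simp only [Set.mem_empty_iff_false, iff_false]
    rintro ⟨hl, hw⟩
    obtain ⟨M, hl', -⟩ := hw.exists_rotatesBy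
    obtain ⟨r, hr⟩ := hn
    omega
  rw [SC, this, Set.ncard_empty]

end Word

theorem mainTheorem10 (n : ℕ) (hn : 1 ≤ n) :
    (Odd n → Word.SC n = 0) ∧ (Even n → Word.SC n = 2 * Nat.totient (n / 2 + 1)) := by
  refine ⟨Word.SC_of_odd, fun ⟨r, hr⟩ => ?_⟩
  obtain ⟨M, rfl⟩ : ∃ M, n = 2 * M + 2 := ⟨r - 1, by omega⟩
  rw [Word.SC_two_mul_add_two]
  congr 2
  omega
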